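/- **Setting.** A network has $n+1$ nodes, a dealer $D$ and $n$ participants; it is a directed graph (an undirected link is a pair of opposite edges) whose edges are secure private links. $\mathcal N(D)$ is the set of participants with an incoming edge from $D$. A network satisfies the *$m$-propagating-dealer condition* if the participants can be ordered so that each of them is in $\mathcal N(D)$ or has incoming edges from at least $m$ participants preceding it. An algorithm performs *$(n,k)$ secret sharing* on a network if, with a non-deterministic secret held by the dealer, any $k$ participants can together recover the secret from their data, and the data of fewer than $k$ participants is independent of the secret. One unit of data is the size of the secret. The communication $\Gamma$ of a concrete scheme is the total number of field symbols sent over links, in units; that of an arbitrary algorithm (any number of rounds, private randomness at every node) is the sum over all links of the entropy of the data passed over the link, divided by the entropy of the secret. *SNEAK with parameter $d\ge k$*: the secret is a vector in $\mathbb F_q^{\,d-k+1}$, $q>n$; participant $i$ has an encoding vector $\psi_i=(1,x_i,\dots,x_i^{d-1})^T$ with distinct nonzero $x_i\in\mathbb F_q$; the dealer forms the symmetric $d\times d$ matrix $$M=\begin{pmatrix}S_A&R_a^T&S_B^T\\R_a&R_b&R_c^T\\S_B&R_c&0\end{pmatrix}$$ (blocks of sizes $1,k-1,d-k$), where $S_A,S_B$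 contain the secret and $R_a,R_b=R_b^T,R_c$ are random, and sends $\psi_j^TM$ to each $j\in\mathcal N(D)$. A participant outside $\mathcal N(D)$ waits for one value from each of $d$ neighbours and computes from them, by inverting a Vandermonde matrix, the vector $v=M\psi_\ell$; a participant holding its vector $v$ passes $v^T\psi_j$ to each out-neighbour $j\notin\mathcal N(D)$ that has not yet received $d$ values. The transmissions may take place in any order. *The state-of-the-art scheme (sota)*: each participant in $\mathcal N(D)$ gets its Shamir share (one unit) directly. For every other participant $i$ the dealer chooses $w\ge k$ node-disjoint paths to $i$, encodes the share of $i$ by two-threshold secret sharing into $w$ chunks of $\frac1{w-k+1}$ units each, and passes one chunk along each path; $w$ and the paths are chosen so that the communication is minimal ($\Gamma_{\rm sota}=\infty$ if for some such $i$ there are no $k$ node-disjoint paths). **Theorem.** Let $2\le k\le d$ be fixed. 1. There are constants $c,C,K>0$ depending only on $k$ and $d$ such that for all $n\ge k$ and every network with $n$ participants satisfying the $d$-propagating-dealer condition (for $d=k$: the $k$-propagating-dealer condition), SNEAK with parameter $d$ has a complete execution, and every complete execution has communication $\Gamma_{\rm SNEAK}$ with $c\,n\le\Gamma_{\rm SNEAK}\le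 C\,n$ and $\Gamma_{\rm SNEAK}\le K\,\Gamma_{\rm any}$ for every algorithm that performs $(n,k)$ secret sharing on this network. 2. Let $\varepsilon>0$ and let $(\mathcal G_m)$ be a sequence of networks with $n_m\to\infty$ participants and maximum outgoing degree $O\big((\log n_m)^{1/2-\varepsilon}\big)$. Then $\Gamma_{\rm sota}(\mathcal G_m)$ is super-linear: $\Gamma_{\rm sota}(\mathcal G_m)/n_m\to\infty$. 3. There is a class of networks, containing for every $n>d$ at least one network with $n$ participants, such that every network of the class with $n>d$ participants satisfies the $d$-propagating-dealer condition and has $c'n^2\le\Gamma_{\rm sota}\le C'n^2$, where $c',C'>0$ depend only on $k$ and $d$. -/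

import Mathlib

open Filter Topology Asymptotics
open scoped NNReal ENNReal

namespace SecretSharing

/-! ## Networks -/

/-- A network with `n` participants: node `none` is the dealer, node `some i` is participant `i`.
An undirected link is a pair of opposite edges. -/
abbrev Network (n : ℕ) := Digraph (Option (Fin n))

/-- Participant `i` is directly connected to the dealer. -/
def Direct {n : ℕ} (G : Network n) (i : Fin n) : Prop := G.Adj none (some i)

/-- The `m`-propagating-dealer condition: for some ordering of the participants, each of them has
an incoming edge from the dealer, or incoming edges from at least `m` participants preceding it. -/
def PropagatingDealer {n : ℕ} (G : Network n) (m : ℕ) : Prop :=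
  ∃ rank : Fin n ≃ Fin n, ∀ i : Fin n,
    Direct G i ∨ m ≤ {j : Fin n | rank j < rank i ∧ G.Adj (some j) (some i)}.ncard

/-- The maximum outgoing degree, over all nodes including the dealer. -/
noncomputable def maxOutDegree {n : ℕ} (G : Network n) : ℕ :=
  Finset.univ.sup fun u : Option (Fin n) => {v | G.Adj u v}.ncard

/-- A transmission over one link, carrying a list of field symbols. -/
structure Message (n : ℕ) (F : Type) where
  src : Option (Fin n)
  dst : Option (Fin n)
  payload : List F

/-- The total number of field symbols transmitted. -/
def symbols {n : ℕ} {F : Type} (log : List (Message n F)) : ℕ :=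
  (log.map fun m => m.payload.length).sum

/-! ## The SNEAK algorithm -/

/-- The data of an instance of SNEAK: a finite field, distinct nonzero evaluation points of the
participants (so that the field has more than `n` elements), the secret, which consists of
`d - k + 1` field symbols, and the values of the random symbols drawn by the dealer. -/
structure SneakSetup (n k d : ℕ) where
  one_le : 1 ≤ k
  le : k ≤ d
  F : Type
  [field : Field F]
  [fintype : Fintype F]
  point : Fin n → F
  point_injective : Function.Injective point
  point_ne_zero : ∀ i, point i ≠ 0
  secret : Fin (d - k + 1) → F
  Ra : Fin (k - 1) → F
  Rb : Matrix (Fin (k - 1)) (Fin (k - 1)) F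
  Rb_symm : Rb.IsSymm
  Rc : Matrix (Fin (d - k)) (Fin (k - 1)) F

attribute [instance] SneakSetup.field SneakSetup.fintype

namespace SneakSetup

variable {n k d : ℕ} (S : SneakSetup n k d)

/-- `S_A`, the last symbol of the secret. -/
def SA : S.F := S.secret (Fin.last (d - k))

/-- `S_B`, the first `d - k` symbols of the secret. -/
def SB : Fin (d - k) → S.F := fun j => S.secret j.castSucc

/-- The position of the blocks of sizes `1`, `k - 1`, `d - k` in `{0, …, d - 1}`. -/
def blockEquiv : Fin 1 ⊕ (Fin (k - 1) ⊕ Fin (d - k)) ≃ Fin d :=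
  ((Equiv.refl (Fin 1)).sumCongr finSumFinEquiv).trans
    (finSumFinEquiv.trans (finCongr (by have := S.one_le; have := S.le; omega)))

/-- The symmetric `d × d` matrix with blocks
`[S_A, R_aᵀ, S_Bᵀ; R_a, R_b, R_cᵀ; S_B, R_c, 0]`. -/
def M : Matrix (Fin d) (Fin d) S.F :=
  Matrix.reindex S.blockEquiv S.blockEquiv
    (Matrix.fromBlocks
      (Matrix.of fun _ _ => S.SA)
      (Matrix.fromCols (Matrix.replicateRow (Fin 1) S.Ra) (Matrix.replicateRow (Fin 1) S.SB))
      (Matrix.fromRows (Matrix.replicateCol (Fin 1) S.Ra) (Matrix.replicateCol (Fin 1) S.SB))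
      (Matrix.fromBlocks S.Rb S.Rc.transpose S.Rc 0))

/-- The encoding vector `(1, x_i, x_i ^ 2, …, x_i ^ (d - 1))` of participant `i`. -/
def psi (i : Fin n) : Fin d → S.F := fun j => S.point i ^ (j : ℕ)

/-- After the transmissions in `log`, participant `i` holds the vector `v`: it has received `v`
from the dealer, or it is not connected to the dealer and has computed `v` from one value from
each of `d` distinct neighbours. -/
inductive Holds (G : Network n) (log : List (Message n S.F)) (i : Fin n) : (Fin d → S.F) → Prop
  | dealt (v : Fin d → S.F) (hv : Message.mk none (some i) (List.ofFn v) ∈ log) :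
      Holds G log i v
  | solved (hi : ¬ Direct G i) (nb : Fin d → Fin n) (hnb : Function.Injective nb)
      (σ : Fin d → S.F)
      (hσ : ∀ a, Message.mk (some (nb a)) (some i) [σ a] ∈ log) :
      Holds G log i ((Matrix.of fun a => S.psi (nb a))⁻¹.mulVec σ)

/-- One transmission of the algorithm. The dealer passes `ψ_jᵀ M` to a neighbour `j`, once.
A participant `i` holding a vector `v` passes `vᵀ ψ_j` to a neighbour `j`, once, provided that
`j` still requires data (handshake): `j` is not connected to the dealer and has received fewer
than `d` values. In particular nothing is passed back to a neighbour from whom data came. -/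
inductive Step (G : Network n) : List (Message n S.F) → List (Message n S.F) → Prop
  | deal (log : List (Message n S.F)) (j : Fin n) (hj : Direct G j)
      (hfresh : ∀ m ∈ log, ¬ (m.src = none ∧ m.dst = some j)) :
      Step G log (Message.mk none (some j) (List.ofFn (Matrix.vecMul (S.psi j) S.M)) :: log)
  | pass (log : List (Message n S.F)) (i j : Fin n) (v : Fin d → S.F)
      (hij : G.Adj (some i) (some j)) (hv : S.Holds G log i v)
      (hj : ¬ Direct G j)
      (hneed : log.countP (fun m => decide (m.dst = some j)) < d)
      (hfresh : ∀ m ∈ log, ¬ (m.src = some i ∧ m.dst = some j)) :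
      Step G log (Message.mk (some i) (some j) [v ⬝ᵥ S.psi j] :: log)

/-- `log` (latest transmission first) is the record of a completed execution: it arises from the
empty record by steps of the algorithm, in any order, and no further step is possible. -/
def CompleteRun (G : Network n) (log : List (Message n S.F)) : Prop :=
  Relation.ReflTransGen (S.Step G) [] log ∧ ∀ log', ¬ S.Step G log log'

/-- Communication of an execution, in units of the size of the secret (`d - k + 1` symbols). -/
noncomputable def comm (log : List (Message n S.F)) : ℝ :=
  (symbols log : ℝ) / ((d - k + 1 : ℕ) : ℝ)

end SneakSetup

/-! ## Arbitrary secret sharing algorithms -/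

/-- Shannon entropy (in nats) of the random variable `X` on the finite probability space with
point masses `p`. -/
noncomputable def entropy {Ω α : Type*} [Fintype Ω] (p : Ω → ℝ) (X : Ω → α) : ℝ :=
  open Classical in
  ∑ x ∈ Finset.univ.image X, Real.negMulLog (∑ ω ∈ Finset.univ.filter (fun ω => X ω = x), p ω)

/-- Probability of an event on the finite probability space with point masses `p`. -/
noncomputable def prob {Ω : Type*} [Fintype Ω] (p : Ω → ℝ) (E : Ω → Prop) : ℝ :=
  open Classical in ∑ ω ∈ Finset.univ.filter E, p ω

/-- A distributed algorithm for the dealer and `n` participants. The dealer holds a random secret,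
every node has independent private randomness, and communication proceeds in rounds. In each
round node `u` sends to node `v` a message, or nothing (`none`), as a function `send u v` of all
that `u` knows: the secret if `u` is the dealer, its private randomness, and everything it has
received in the earlier rounds. -/
structure Protocol (n : ℕ) where
  Secret : Type
  [secretFintype : Fintype Secret]
  secretLaw : PMF Secret
  Rand : Option (Fin n) → Type
  [randFintype : ∀ v, Fintype (Rand v)]
  randLaw : ∀ v, PMF (Rand v)
  Msg : Type
  rounds : ℕ
  send : ∀ u _v : Option (Fin n), Option Secret → Rand u →
    List (Option (Fin n) → Option Msg) → Option Msg

attribute [instance] Protocol.secretFintype Protocol.randFintype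

namespace Protocol

variable {n : ℕ} (P : Protocol n)

/-- The outcomes: a value of the secret and of the private randomness of every node. -/
abbrev Outcome := P.Secret × (∀ v, P.Rand v)

/-- The probability of an outcome; the secret and the private random values are independent. -/
noncomputable def weight (ω : P.Outcome) : ℝ :=
  (P.secretLaw ω.1).toReal * ∏ v, (P.randLaw v (ω.2 v)).toReal

/-- Only the dealer has the secret as an input. -/
def input (ω : P.Outcome) : Option (Fin n) → Option P.Secret
  | none => some ω.1
  | some _ => none

/-- What node `v` has received in the first `t` rounds: for each round, the message (or silence)
from every node. Messages travel over the edges of `G` only. -/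
noncomputable def inbox (G : Network n) (ω : P.Outcome) :
    ℕ → Option (Fin n) → List (Option (Fin n) → Option P.Msg)
  | 0, _ => []
  | t + 1, v => inbox G ω t v ++ [fun u =>
      open Classical in
      if G.Adj u v then P.send u v (P.input ω u) (ω.2 u) (inbox G ω t u) else none]

/-- Everything that participant `i` knows at the end. -/
noncomputable def view (G : Network n) (ω : P.Outcome) (i : Fin n) :
    P.Rand (some i) × List (Option (Fin n) → Option P.Msg) :=
  (ω.2 (some i), P.inbox G ω P.rounds (some i))

/-- All the data passed by node `u` to node `v`. -/
noncomputable def transcript (G : Network n) (u v : Option (Fin n)) (ω : P.Outcome) :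
    List (Option P.Msg) :=
  (P.inbox G ω P.rounds v).map fun f => f u

/-- The entropy of the secret, that is, the size of one unit of data. -/
noncomputable def secretEntropy : ℝ := entropy P.weight (fun ω : P.Outcome => ω.1)

/-- The algorithm performs `(n, k)` secret sharing on `G`: the secret is not deterministic, any
`k` participants can together recover it, and the data of fewer than `k` participants is
independent of it. -/
structure IsSecretSharing (G : Network n) (k : ℕ) : Prop where
  nontrivial : 0 < P.secretEntropy
  recovery : ∀ I : Finset (Fin n), I.card = k →
    ∃ dec : (∀ i : I, P.Rand (some i.1) × List (Option (Fin n) → Option P.Msg)) → P.Secret,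
      ∀ ω, P.weight ω ≠ 0 → dec (fun i => P.view G ω i.1) = ω.1
  secrecy : ∀ J : Finset (Fin n), J.card < k → ∀ (s : P.Secret)
    (w : ∀ i : J, P.Rand (some i.1) × List (Option (Fin n) → Option P.Msg)),
      prob P.weight (fun ω => ω.1 = s ∧ (fun i : J => P.view G ω i.1) = w) =
        prob P.weight (fun ω => ω.1 = s) *
          prob P.weight (fun ω => (fun i : J => P.view G ω i.1) = w)

/-- Communication complexity: the sum over all links of the entropy of the data passed over the
link, in units of the size of the secret. (A pair of nodes that is not an edge contributes `0`.) -/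
noncomputable def comm (G : Network n) : ℝ :=
  (∑ u, ∑ v, entropy P.weight (P.transcript G u v)) / P.secretEntropy

end Protocol

/-! ## Separate secure transmissions over node-disjoint paths -/

/-- The data of an instance of the scheme: a finite field, distinct nonzero evaluation points, a
secret of `len` field symbols, and the values of the random symbols drawn by the dealer.
Symbols have positions `0, …, len - 1`; other positions are not used. The length `len` is such
that a share can be cut into any number `b ≤ n` of equal parts. -/
structure SotaSetup (n k : ℕ) where
  F : Type
  [field : Field F]
  [fintype : Fintype F]
  point : ℕ → F
  point_injOn : Set.InjOn point (Set.Iio n)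
  point_ne_zero : ∀ i < n, point i ≠ 0
  len : ℕ
  len_pos : 0 < len
  dvd_len : ∀ b, 1 ≤ b → b ≤ n → b ∣ len
  secret : ℕ → F
  shareRand : Fin (k - 1) → ℕ → F
  chunkRand : Fin n → Fin (k - 1) → ℕ → F

attribute [instance] SotaSetup.field SotaSetup.fintype

/-- A choice of `w ≥ k` node-disjoint paths from the dealer to participant `i`; `mid a` lists the
intermediate nodes of the `a`-th path. -/
structure Routes {n : ℕ} (G : Network n) (k : ℕ) (i : Fin n) where
  w : ℕ
  le_w : k ≤ w
  mid : Fin w → List (Fin n)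
  isPath : ∀ a, List.IsChain G.Adj (none :: (mid a ++ [i]).map some)
  nodup : ∀ a, (mid a ++ [i]).Nodup
  disjoint : ∀ a b, a ≠ b → List.Disjoint (mid a) (mid b)

/-- The nodes of the `a`-th path, from the dealer to participant `i`. -/
def Routes.nodes {n : ℕ} {G : Network n} {k : ℕ} {i : Fin n} (r : Routes G k i) (a : Fin r.w) :
    List (Option (Fin n)) :=
  none :: (r.mid a ++ [i]).map some

namespace SotaSetup

variable {n k : ℕ} (S : SotaSetup n k)

/-- Shamir share of participant `i`, symbol by symbol. -/
def share (i : Fin n) (p : ℕ) : S.F :=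
  S.secret p + ∑ e : Fin (k - 1), S.point i ^ ((e : ℕ) + 1) * S.shareRand e p

/-- The `a`-th of the `w` chunks into which the share of participant `i` is encoded by
two-threshold secret sharing: all `w` chunks determine the share, any `k - 1` of them reveal
nothing about it. The share is cut into `w - k + 1` parts of `len / (w - k + 1)` symbols, which
together with `k - 1` random parts are the coefficients of polynomials of degree less than `w`;
the chunk consists of their values at the `a`-th point. -/
def chunk (i : Fin n) (w a : ℕ) : List S.F :=
  List.ofFn fun p : Fin (S.len / (w - k + 1)) =>
    (∑ c : Fin (w - k + 1), S.point a ^ (c : ℕ) * S.share i (c * (S.len / (w - k + 1)) + p)) +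
      ∑ e : Fin (k - 1), S.point a ^ (w - k + 1 + (e : ℕ)) * S.chunkRand i e p

/-- The transmission of the share of a participant that is connected to the dealer. -/
def directMessages (i : Fin n) : List (Message n S.F) :=
  [Message.mk none (some i) (List.ofFn fun p : Fin S.len => S.share i p)]

/-- The transmissions of the share of participant `i` over the chosen paths: the `a`-th chunk is
passed along every hop of the `a`-th path. -/
def routedMessages {G : Network n} {i : Fin n} (r : Routes G k i) : List (Message n S.F) :=
  (List.finRange r.w).flatMap fun a =>
    ((r.nodes a).zip (r.nodes a).tail).map fun uv => Message.mk uv.1 uv.2 (S.chunk i r.w a)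

/-- Communication complexity of the scheme on `G`, in units of the size of the secret: for each
participant in turn, the paths are chosen so as to minimize the communication. It is `∞` if
some participant outside the neighbourhood of the dealer has no `k` node-disjoint paths. -/
noncomputable def comm (G : Network n) : ℝ≥0∞ :=
  ∑ i : Fin n,
    open Classical in
    if Direct G i then (symbols (S.directMessages i) : ℝ≥0∞) / (S.len : ℝ≥0∞)
    else ⨅ r : Routes G k i, (symbols (S.routedMessages r) : ℝ≥0∞) / (S.len : ℝ≥0∞)

end SotaSetup

end SecretSharing

/-! SNEAK: in a complete execution every participant receives exactly `d` symbols, whatever the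
order of transmissions. The handshake gives at most `d`. Completeness and induction along the
propagating order give at least `d`: a participant short of `d` values has a predecessor that can
compute a vector and has not sent to it, so a further step would be possible. Hence the
communication is exactly `d * n` symbols. Only the number of values matters for this count, not what
they are.

Arbitrary algorithms: fix a participant `i` and `k - 1` others. The views of the others are
independent of the secret, yet together with the traffic on the links of `i` they determine it.
Determination by the traffic alone, without the private randomness of `i`, is a splicing argument
(`inbox_replaceRand`, `secret_eq_of_linkData_eq`): exchanging the randomness of `i` between two
outcomes with equal traffic changes no message. So the traffic at each participant has at least the
entropy of the secret, and summing over participants counts each link at most twice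
(`le_two_mul_comm`).

Separate transmissions: sending a share over `w` disjoint paths costs `w / (w - k + 1) ≥ 1` units
per hop when all paths are equally long, so a participant costs at least its distance from the
dealer (`sum_le_comm`). With polylogarithmic outgoing degrees a ball of fixed radius contains a
vanishing fraction of the nodes, so the average distance is unbounded. In `slidingNetwork` one hop
advances by at most `d` positions, so distances grow linearly and their sum quadratically; the
residue classes mod `d` provide disjoint paths for the matching upper bound. -/

namespace SecretSharing

/-! ## Entropy of random variables on a finite probability space -/

section Entropy

variable {Ω α β : Type*} [Fintype Ω] {p : Ω → ℝ}

open Classical in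
/-- The point mass at `x` of the law of `X`. -/
noncomputable def lawMass (p : Ω → ℝ) (X : Ω → α) (x : α) : ℝ :=
  ∑ ω ∈ Finset.univ.filter (fun ω => X ω = x), p ω

theorem lawMass_nonneg (hp : ∀ ω, 0 ≤ p ω) (X : Ω → α) (x : α) : 0 ≤ lawMass p X x :=
  Finset.sum_nonneg fun ω _ => hp ω

theorem le_lawMass (hp : ∀ ω, 0 ≤ p ω) (X : Ω → α) (ω : Ω) : p ω ≤ lawMass p X (X ω) := by
  classical
  exact Finset.single_le_sum (f := p) (fun ω _ => hp ω) (by simp)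

theorem lawMass_pos (hp : ∀ ω, 0 ≤ p ω) (X : Ω → α) {ω : Ω} (hω : p ω ≠ 0) :
    0 < lawMass p X (X ω) :=
  lt_of_lt_of_le (lt_of_le_of_ne (hp ω) hω.symm) (le_lawMass hp X ω)

theorem sum_image_lawMass_mul [DecidableEq α] (p : Ω → ℝ) (X : Ω → α) (f : α → ℝ) :
    ∑ x ∈ Finset.univ.image X, lawMass p X x * f x = ∑ ω, p ω * f (X ω) := by
  classical
  rw [← Finset.sum_fiberwise_of_maps_to (s := Finset.univ) (t := Finset.univ.image X) (g := X)
    (fun ω _ => Finset.mem_image_of_mem X (Finset.mem_univ ω))]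
  refine Finset.sum_congr rfl fun x _ => ?_
  rw [lawMass, Finset.sum_mul]
  refine Finset.sum_congr (by congr) fun ω hω => ?_
  rw [(Finset.mem_filter.1 hω).2]

/-- Writing entropy as an expectation over outcomes lets variables with different ranges be compared
outcome by outcome. -/
theorem entropy_eq_sum (p : Ω → ℝ) (X : Ω → α) :
    entropy p X = ∑ ω, p ω * -Real.log (lawMass p X (X ω)) := by
  classical
  rw [← sum_image_lawMass_mul p X (fun x => -Real.log (lawMass p X x))]
  unfold entropy
  refine Finset.sum_congr (by congr) fun x _ => ?_
  rw [Real.negMulLog, lawMass]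
  ring_nf

theorem sum_image_lawMass [DecidableEq α] (p : Ω → ℝ) (X : Ω → α) :
    ∑ x ∈ Finset.univ.image X, lawMass p X x = ∑ ω, p ω := by
  simpa using sum_image_lawMass_mul p X (fun _ => 1)

/-- If `X` determines `Y` almost surely, the entropy of `Y` is at most that of `X`. -/
theorem entropy_le_of_determines (hp : ∀ ω, 0 ≤ p ω) {X : Ω → α} {Y : Ω → β}
    (h : ∀ ω ω', p ω ≠ 0 → p ω' ≠ 0 → X ω = X ω' → Y ω = Y ω') :
    entropy p Y ≤ entropy p X := by
  classical
  rw [entropy_eq_sum, entropy_eq_sum]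
  refine Finset.sum_le_sum fun ω _ => ?_
  by_cases hω : p ω = 0
  · simp [hω]
  -- Up to null outcomes, each fibre of `X` lies inside a fibre of `Y`, whose mass is therefore at
  -- least as large.
  refine mul_le_mul_of_nonneg_left (neg_le_neg (Real.log_le_log (lawMass_pos hp X hω) ?_)) (hp ω)
  unfold lawMass
  rw [Finset.sum_filter, Finset.sum_filter]
  refine Finset.sum_le_sum fun ω' _ => ?_
  by_cases hω' : p ω' = 0
  · simp [hω']
  split_ifs with h1 h2 h2
  · exact le_rfl
  · exact absurd (h ω' ω hω' hω h1) h2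
  · exact hp ω'
  · exact le_rfl

theorem entropy_const (hp1 : ∑ ω, p ω = 1) {X : Ω → α} (h : ∀ ω ω', X ω = X ω') :
    entropy p X = 0 := by
  classical
  rw [entropy_eq_sum]
  refine Finset.sum_eq_zero fun ω _ => ?_
  have : lawMass p X (X ω) = 1 := by
    rw [lawMass, Finset.filter_true_of_mem (fun ω' _ => h ω' ω), hp1]
  simp [this]

/-- Gibbs' inequality: apply `log t ≤ t - 1` to the ratio of the product of the marginals to the
joint mass. The expectation of this ratio is a sum of products of marginals over the range of the
pair, hence at most `1`. -/
theorem entropy_prodMk_le (hp : ∀ ω, 0 ≤ p ω) (hp1 : ∑ ω, p ω = 1) (X : Ω → α) (Y : Ω → β) :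
    entropy p (fun ω => (X ω, Y ω)) ≤ entropy p X + entropy p Y := by
  classical
  set Z : Ω → α × β := fun ω => (X ω, Y ω) with hZ
  rw [entropy_eq_sum, entropy_eq_sum, entropy_eq_sum, ← Finset.sum_add_distrib, ← sub_nonpos,
    ← Finset.sum_sub_distrib]
  have key : ∀ ω, p ω * -Real.log (lawMass p Z (Z ω)) -
      (p ω * -Real.log (lawMass p X (X ω)) + p ω * -Real.log (lawMass p Y (Y ω))) ≤
      p ω * (lawMass p X (Z ω).1 * lawMass p Y (Z ω).2 / lawMass p Z (Z ω)) - p ω := by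
    intro ω
    by_cases hω : p ω = 0
    · simp [hω]
    have hX := lawMass_pos hp X hω
    have hY := lawMass_pos hp Y hω
    have hZ' := lawMass_pos hp Z hω
    have := Real.log_le_sub_one_of_pos (div_pos (mul_pos hX hY) hZ')
    rw [Real.log_div (mul_pos hX hY).ne' hZ'.ne', Real.log_mul hX.ne' hY.ne'] at this
    have := mul_le_mul_of_nonneg_left this (hp ω)
    simp only [hZ] at this ⊢
    linarith
  refine (Finset.sum_le_sum fun ω _ => key ω).trans ?_
  rw [Finset.sum_sub_distrib, hp1, sub_nonpos,
    ← sum_image_lawMass_mul p Z (fun z => lawMass p X z.1 * lawMass p Y z.2 / lawMass p Z z)]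
  calc ∑ z ∈ Finset.univ.image Z, lawMass p Z z * (lawMass p X z.1 * lawMass p Y z.2 / lawMass p Z z)
      ≤ ∑ z ∈ Finset.univ.image Z, lawMass p X z.1 * lawMass p Y z.2 := by
        refine Finset.sum_le_sum fun z _ => ?_
        have hn := mul_nonneg (lawMass_nonneg hp X z.1) (lawMass_nonneg hp Y z.2)
        rcases eq_or_ne (lawMass p Z z) 0 with h0 | h0
        · rw [h0]; simpa using hn
        · rw [mul_div_cancel₀ _ h0]
    _ ≤ ∑ z ∈ Finset.univ.image X ×ˢ Finset.univ.image Y, lawMass p X z.1 * lawMass p Y z.2 := by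
        refine Finset.sum_le_sum_of_subset_of_nonneg ?_ fun z _ _ =>
          mul_nonneg (lawMass_nonneg hp X z.1) (lawMass_nonneg hp Y z.2)
        intro z hz
        obtain ⟨ω, -, rfl⟩ := Finset.mem_image.1 hz
        simp [hZ]
    _ = 1 := by
        rw [Finset.sum_product, ← Finset.sum_mul_sum, sum_image_lawMass, sum_image_lawMass, hp1,
          one_mul]

theorem entropy_pi_le {ι : Type*} [Fintype ι] {γ : ι → Type*} (hp : ∀ ω, 0 ≤ p ω)
    (hp1 : ∑ ω, p ω = 1) (X : ∀ i, Ω → γ i) :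
    entropy p (fun ω i => X i ω) ≤ ∑ i, entropy p (X i) := by
  classical
  have key : ∀ s : Finset ι, entropy p (fun ω (i : s) => X i ω) ≤ ∑ i ∈ s, entropy p (X i) := by
    intro s
    induction s using Finset.induction_on with
    | empty => exact (entropy_const hp1 fun ω ω' => funext fun i => absurd i.2 (Finset.notMem_empty _)).le
    | insert a s ha ih =>
      rw [Finset.sum_insert ha]
      refine le_trans ?_ ((entropy_prodMk_le hp hp1 (X a) (fun ω (i : s) => X i ω)).trans
        (by gcongr))
      refine entropy_le_of_determines hp fun ω ω' _ _ h => ?_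
      rw [Prod.mk.injEq] at h
      funext i
      rcases Finset.mem_insert.1 i.2 with hi | hi
      · obtain ⟨i, hi'⟩ := i
        change i = a at hi
        subst hi
        exact h.1
      · exact congrFun h.2 ⟨i, hi⟩
  refine le_trans ?_ (key Finset.univ)
  exact entropy_le_of_determines hp fun ω ω' _ _ h =>
    funext fun i => congrFun h ⟨i, Finset.mem_univ i⟩

theorem entropy_prodMk_eq_of_indep (hp : ∀ ω, 0 ≤ p ω) {X : Ω → α} {Y : Ω → β}
    (h : ∀ x y, lawMass p (fun ω => (X ω, Y ω)) (x, y) = lawMass p X x * lawMass p Y y) :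
    entropy p (fun ω => (X ω, Y ω)) = entropy p X + entropy p Y := by
  rw [entropy_eq_sum, entropy_eq_sum, entropy_eq_sum, ← Finset.sum_add_distrib]
  refine Finset.sum_congr rfl fun ω _ => ?_
  by_cases hω : p ω = 0
  · simp [hω]
  rw [h, Real.log_mul (lawMass_pos hp X hω).ne' (lawMass_pos hp Y hω).ne']
  ring

end Entropy

/-! ## Every secret sharing algorithm has linear communication -/

namespace Protocol

variable {n : ℕ} (P : Protocol n)

theorem weight_nonneg (ω : P.Outcome) : 0 ≤ P.weight ω :=
  mul_nonneg ENNReal.toReal_nonneg (Finset.prod_nonneg fun _ _ => ENNReal.toReal_nonneg)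

theorem _root_.PMF.sum_toReal {α : Type*} [Fintype α] (q : PMF α) : ∑ a, (q a).toReal = 1 := by
  rw [← ENNReal.toReal_sum fun a _ => q.apply_ne_top a, ← tsum_fintype (L := .unconditional _),
    q.tsum_coe, ENNReal.toReal_one]

theorem sum_weight : ∑ ω, P.weight ω = 1 := by
  unfold weight
  rw [Fintype.sum_prod_type]
  simp_rw [← Finset.mul_sum]
  have : ∑ r : (∀ v, P.Rand v), ∏ v, (P.randLaw v (r v)).toReal = 1 := by
    rw [← Fintype.piFinset_univ,
      ← Finset.prod_univ_sum (fun _ => Finset.univ) fun v x => (P.randLaw v x).toReal]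
    simp [PMF.sum_toReal]
  rw [this]
  simp [PMF.sum_toReal]

theorem weight_ne_zero_iff (ω : P.Outcome) :
    P.weight ω ≠ 0 ↔ (P.secretLaw ω.1).toReal ≠ 0 ∧ ∀ v, (P.randLaw v (ω.2 v)).toReal ≠ 0 := by
  unfold weight
  rw [mul_ne_zero_iff, Finset.prod_ne_zero_iff]
  simp

/-- The message that arrives at `v` from `u` in round `t`. -/
noncomputable def arrival (G : Network n) (ω : P.Outcome) (t : ℕ) (u v : Option (Fin n)) :
    Option P.Msg :=
  open Classical in
  if G.Adj u v then P.send u v (P.input ω u) (ω.2 u) (P.inbox G ω t u) else none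

theorem inbox_succ (G : Network n) (ω : P.Outcome) (t : ℕ) (v : Option (Fin n)) :
    P.inbox G ω (t + 1) v = P.inbox G ω t v ++ [fun u => P.arrival G ω t u v] := rfl

theorem inbox_eq_map (G : Network n) (ω : P.Outcome) (t : ℕ) (v : Option (Fin n)) :
    P.inbox G ω t v = (List.range t).map fun s u => P.arrival G ω s u v := by
  induction t with
  | zero => rfl
  | succ t ih => rw [inbox_succ, ih, List.range_succ, List.map_append, List.map_singleton]

theorem transcript_eq_iff (G : Network n) (u v : Option (Fin n)) (ω ω' : P.Outcome) :
    P.transcript G u v ω = P.transcript G u v ω' ↔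
      ∀ t < P.rounds, P.arrival G ω t u v = P.arrival G ω' t u v := by
  unfold transcript
  rw [inbox_eq_map, inbox_eq_map, List.map_map, List.map_map, List.map_inj_left]
  simp

/-- All the data passed over the links of node `v`, in both directions. -/
noncomputable def linkData (G : Network n) (v : Option (Fin n)) (ω : P.Outcome) :
    (Option (Fin n) ⊕ Option (Fin n)) → List (Option P.Msg) :=
  Sum.elim (fun u => P.transcript G u v ω) (fun u => P.transcript G v u ω)

/-- The outcome `ω` with the private randomness of participant `i` replaced. -/
def replaceRand (ω : P.Outcome) (i : Fin n) (r : P.Rand (some i)) : P.Outcome :=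
  (ω.1, Function.update ω.2 (some i) r)

/-- Independence of the private randomness makes the support a product set, so splicing two possible
outcomes gives a possible outcome. -/
theorem replaceRand_weight {ω ω' : P.Outcome} (hω : P.weight ω ≠ 0) (hω' : P.weight ω' ≠ 0)
    (i : Fin n) : P.weight (P.replaceRand ω i (ω'.2 (some i))) ≠ 0 := by
  rw [weight_ne_zero_iff] at *
  refine ⟨hω.1, fun v => ?_⟩
  by_cases hv : v = some i
  · subst hv
    simpa [replaceRand] using hω'.2 (some i)
  · simpa [replaceRand, Function.update_of_ne hv] using hω.2 v

/-- Replacing the private randomness of a participant by one that is consistent with the data on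
its links changes no message. -/
theorem inbox_replaceRand (G : Network n) {ω ω' : P.Outcome} {i : Fin n}
    (h : P.linkData G (some i) ω = P.linkData G (some i) ω') {t : ℕ} (ht : t ≤ P.rounds)
    (v : Option (Fin n)) :
    P.inbox G (P.replaceRand ω i (ω'.2 (some i))) t v = P.inbox G ω t v := by
  have hin : ∀ u, ∀ t < P.rounds, P.arrival G ω t u (some i) = P.arrival G ω' t u (some i) :=
    fun u => (P.transcript_eq_iff G _ _ _ _).1 (congrFun h (Sum.inl u))
  have hout : ∀ u, ∀ t < P.rounds, P.arrival G ω t (some i) u = P.arrival G ω' t (some i) u :=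
    fun u => (P.transcript_eq_iff G _ _ _ _).1 (congrFun h (Sum.inr u))
  induction t generalizing v with
  | zero => rfl
  | succ t ih =>
    have ih := fun v => ih (by omega) v
    rw [inbox_succ, inbox_succ, ih]
    congr 2
    funext u
    by_cases hu : u = some i
    · subst hu
      -- In the spliced run participant `i` acts on the randomness of `ω'` and on an inbox shared
      -- with `ω'`, so it sends what it sends in `ω'`, which by `hout` is what it sends in `ω`. The
      -- secrets may differ, but a participant has no access to them.
      rw [hout v t (by omega)]
      have hbox : P.inbox G ω t (some i) = P.inbox G ω' t (some i) := by
        rw [inbox_eq_map, inbox_eq_map, List.map_inj_left]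
        intro s hs
        funext u
        exact hin u s (by have := List.mem_range.1 hs; omega)
      unfold arrival
      rw [ih, hbox]
      simp [replaceRand, input]
    · unfold arrival
      rw [ih]
      have : P.input (P.replaceRand ω i (ω'.2 (some i))) u = P.input ω u := by
        cases u <;> rfl
      rw [this]
      simp [replaceRand, Function.update_of_ne hu]

/-- The data on the links of participant `i`, together with the views of `k - 1` others,
determines the secret. -/
theorem secret_eq_of_linkData_eq {G : Network n} {k : ℕ} (hP : P.IsSecretSharing G k)
    {J : Finset (Fin n)} {i : Fin n} (hi : i ∉ J) (hJ : J.card + 1 = k) {ω ω' : P.Outcome}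
    (hω : P.weight ω ≠ 0) (hω' : P.weight ω' ≠ 0)
    (hview : (fun j : J => P.view G ω j.1) = fun j : J => P.view G ω' j.1)
    (hlink : P.linkData G (some i) ω = P.linkData G (some i) ω') : ω.1 = ω'.1 := by
  obtain ⟨dec, hdec⟩ := hP.recovery (insert i J) (by rw [Finset.card_insert_of_notMem hi, hJ])
  -- The spliced outcome carries the secret of `ω`, while the `k` participants see in it what they
  -- see in `ω'`; the decoder cannot tell the two apart.
  rw [← hdec ω' hω', show ω.1 = (P.replaceRand ω i (ω'.2 (some i))).1 from rfl,
    ← hdec _ (P.replaceRand_weight hω hω' i)]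
  congr 1
  funext j
  unfold view
  rw [P.inbox_replaceRand G hlink le_rfl]
  obtain ⟨j, hj⟩ := j
  by_cases hji : j = i
  · subst hji
    have : P.inbox G ω P.rounds (some j) = P.inbox G ω' P.rounds (some j) := by
      rw [inbox_eq_map, inbox_eq_map, List.map_inj_left]
      intro s hs
      funext u
      exact (P.transcript_eq_iff G _ _ _ _).1 (congrFun hlink (Sum.inl u)) s (List.mem_range.1 hs)
    simp [replaceRand, this]
  · have hjJ : j ∈ J := (Finset.mem_insert.1 hj).resolve_left hji
    have hne : (some j : Option (Fin n)) ≠ some i := by simpa using hji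
    have := congrFun hview ⟨j, hjJ⟩
    simp only [view] at this
    simpa [replaceRand, Function.update_of_ne hne] using this

/-- With `A` the views of `k - 1` other participants and `T` the link data: `H(S) + H(A) = H(S, A) ≤
H(A, T) ≤ H(A) + H(T)`, by secrecy, recovery and subadditivity in turn. -/
theorem secretEntropy_le_linkData {G : Network n} {k : ℕ} (hk : 1 ≤ k) (hn : k ≤ n)
    (hP : P.IsSecretSharing G k) (i : Fin n) :
    P.secretEntropy ≤ entropy P.weight (P.linkData G (some i)) := by
  obtain ⟨J, hJsub, hJ⟩ := Finset.exists_subset_card_eq (s := Finset.univ.erase i) (n := k - 1)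
    (by rw [Finset.card_erase_of_mem (Finset.mem_univ i), Finset.card_univ, Fintype.card_fin]; omega)
  have hi : i ∉ J := fun h => by simpa using hJsub h
  set A : P.Outcome → _ := fun ω => fun j : J => P.view G ω j.1 with hA
  have hindep : entropy P.weight (fun ω => (ω.1, A ω)) =
      entropy P.weight (fun ω : P.Outcome => ω.1) + entropy P.weight A := by
    refine entropy_prodMk_eq_of_indep P.weight_nonneg fun s w => ?_
    have := hP.secrecy J (by omega) s w
    refine Eq.trans ?_ this
    unfold lawMass prob
    refine Finset.sum_congr ?_ fun _ _ => rfl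
    ext ω
    simp only [Finset.mem_filter, Finset.mem_univ, true_and, Prod.mk.injEq, hA]
  have hdet : entropy P.weight (fun ω => (ω.1, A ω)) ≤
      entropy P.weight (fun ω => (A ω, P.linkData G (some i) ω)) := by
    refine entropy_le_of_determines P.weight_nonneg fun ω ω' hω hω' h => ?_
    rw [Prod.mk.injEq] at h
    rw [P.secret_eq_of_linkData_eq hP hi (by omega) hω hω' h.1 h.2, h.1]
  have := entropy_prodMk_le P.weight_nonneg P.sum_weight A (P.linkData G (some i))
  unfold secretEntropy
  linarith

theorem entropy_linkData_le (G : Network n) (v : Option (Fin n)) :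
    entropy P.weight (P.linkData G v) ≤
      ∑ u, entropy P.weight (P.transcript G u v) + ∑ u, entropy P.weight (P.transcript G v u) := by
  have := entropy_pi_le P.weight_nonneg P.sum_weight
    (fun (a : Option (Fin n) ⊕ Option (Fin n)) ω => P.linkData G v ω a)
  rwa [Fintype.sum_sum_type] at this

theorem entropy_nonneg_of_weight {α : Type*} (X : P.Outcome → α) : 0 ≤ entropy P.weight X := by
  have h0 : entropy P.weight (fun _ : P.Outcome => ()) = 0 :=
    entropy_const P.sum_weight fun _ _ => rfl
  rw [← h0]
  exact entropy_le_of_determines P.weight_nonneg fun _ _ _ _ _ => rfl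

/-- The factor `2` is there because each link is counted at its source and at its target when
traffic is summed over all nodes; the dealer's own term is only needed to be nonnegative. -/
theorem le_two_mul_comm {G : Network n} {k : ℕ} (hk : 1 ≤ k) (hn : k ≤ n)
    (hP : P.IsSecretSharing G k) : (n : ℝ) ≤ 2 * P.comm G := by
  unfold comm
  rw [← mul_div_assoc, le_div_iff₀ hP.nontrivial]
  have h1 : ∀ i : Fin n, P.secretEntropy ≤ ∑ u, entropy P.weight (P.transcript G u (some i)) +
      ∑ u, entropy P.weight (P.transcript G (some i) u) := fun i =>
    (P.secretEntropy_le_linkData hk hn hP i).trans (P.entropy_linkData_le G _)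
  have hdealer : 0 ≤ ∑ u, entropy P.weight (P.transcript G u none) +
      ∑ u, entropy P.weight (P.transcript G none u) :=
    add_nonneg (Finset.sum_nonneg fun _ _ => P.entropy_nonneg_of_weight _)
      (Finset.sum_nonneg fun _ _ => P.entropy_nonneg_of_weight _)
  calc (n : ℝ) * P.secretEntropy = ∑ _i : Fin n, P.secretEntropy := by simp
    _ ≤ ∑ v, (∑ u, entropy P.weight (P.transcript G u v) +
          ∑ u, entropy P.weight (P.transcript G v u)) := by
        rw [Fintype.sum_option]
        linarith [Finset.sum_le_sum fun i (_ : i ∈ Finset.univ) => h1 i]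
    _ = 2 * ∑ u, ∑ v, entropy P.weight (P.transcript G u v) := by
        rw [Finset.sum_add_distrib, Finset.sum_comm, two_mul]

end Protocol

end SecretSharing

namespace SecretSharing

/-! ## Communication of SNEAK -/

section Received

variable {n : ℕ} {F : Type}

/-- The number of field symbols that node `v` has received. -/
def received (log : List (Message n F)) (v : Option (Fin n)) : ℕ :=
  symbols (log.filter fun m => m.dst = v)

theorem symbols_cons (m : Message n F) (log : List (Message n F)) :
    symbols (m :: log) = m.payload.length + symbols log := by
  simp [symbols]

theorem received_cons (m : Message n F) (log : List (Message n F)) (v : Option (Fin n)) :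
    received (m :: log) v = (if m.dst = v then m.payload.length else 0) + received log v := by
  unfold received
  by_cases h : m.dst = v <;> simp [h, symbols_cons]

theorem symbols_eq_sum_received (log : List (Message n F)) :
    symbols log = ∑ v, received log v := by
  induction log with
  | nil => simp [symbols, received]
  | cons m log ih => simp [symbols_cons, received_cons, Finset.sum_add_distrib, ih]

theorem length_payload_le_received {log : List (Message n F)} {m : Message n F} (hm : m ∈ log) :
    m.payload.length ≤ received log m.dst := by
  unfold received symbols
  exact List.le_sum_of_mem (List.mem_map.2 ⟨m, by simp [hm], rfl⟩)

end Received

namespace SneakSetup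

variable {n k d : ℕ} (S : SneakSetup n k d)

/-- What every record of an execution satisfies: each link is used at most once; a message is
either a vector sent by the dealer to a neighbour, or a single symbol sent by a participant to a
participant not connected to the dealer; no participant receives more than `d` symbols. -/
structure RunInvariant (G : Network n) (log : List (Message n S.F)) : Prop where
  links_nodup : (log.map fun m => (m.src, m.dst)).Nodup
  shape : ∀ m ∈ log, (∃ j, Direct G j ∧ ∃ v : Fin d → S.F, m = ⟨none, some j, List.ofFn v⟩) ∨
    ∃ i j, ¬ Direct G j ∧ ∃ x, m = ⟨some i, some j, [x]⟩
  received_le : ∀ v, received log v ≤ d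

variable {S} {G : Network n}

theorem RunInvariant.received_none {log : List (Message n S.F)} (h : S.RunInvariant G log) :
    received log none = 0 := by
  have : log.filter (fun m => m.dst = none) = [] := by
    refine List.filter_eq_nil_iff.2 fun m hm => ?_
    rcases h.shape m hm with ⟨j, -, v, rfl⟩ | ⟨i, j, -, x, rfl⟩ <;> simp
  simp [received, this, symbols]

/-- Translates the handshake condition of `Step`, which counts messages, into a count of symbols:
outside the dealer's neighbourhood each message is one symbol. -/
theorem RunInvariant.received_eq_countP {log : List (Message n S.F)} (h : S.RunInvariant G log)
    {j : Fin n} (hj : ¬ Direct G j) :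
    received log (some j) = log.countP fun m => decide (m.dst = some j) := by
  rw [List.countP_eq_length_filter, received, symbols, List.map_congr_left (g := fun _ => 1)]
  · simp
  · intro m hm
    obtain ⟨hm, hdst⟩ := List.mem_filter.1 hm
    rcases h.shape m hm with ⟨i, hi, v, rfl⟩ | ⟨i, i', -, x, rfl⟩
    · obtain rfl : i = j := by simpa using hdst
      exact absurd hi hj
    · rfl

theorem RunInvariant.step {log log' : List (Message n S.F)} (h : S.RunInvariant G log)
    (hs : S.Step G log log') : S.RunInvariant G log' := by
  cases hs with
  | deal j hj hfresh =>
    refine ⟨?_, ?_, fun v => ?_⟩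
    · rw [List.map_cons, List.nodup_cons]
      refine ⟨fun hmem => ?_, h.links_nodup⟩
      obtain ⟨m, hm, he⟩ := List.mem_map.1 hmem
      exact hfresh m hm (Prod.mk.inj he)
    · intro m hm
      rcases List.mem_cons.1 hm with rfl | hm
      · exact Or.inl ⟨j, hj, _, rfl⟩
      · exact h.shape m hm
    · rw [received_cons]
      split_ifs with hv
      · subst hv
        -- A direct neighbour gets nothing from participants and nothing earlier from the dealer, so
        -- the `d` dealt symbols are all it has.
        have : log.filter (fun m => m.dst = some j) = [] := by
          refine List.filter_eq_nil_iff.2 fun m hm hd => ?_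
          rcases h.shape m hm with ⟨i, -, v, rfl⟩ | ⟨i, i', hi', x, rfl⟩
          · exact hfresh _ hm ⟨rfl, by simpa using hd⟩
          · obtain rfl : i' = j := by simpa using hd
            exact hi' hj
        simp [received, this, symbols]
      · simpa using h.received_le v
  | pass i j v hij hv hj hneed hfresh =>
    refine ⟨?_, ?_, fun u => ?_⟩
    · rw [List.map_cons, List.nodup_cons]
      refine ⟨fun hmem => ?_, h.links_nodup⟩
      obtain ⟨m, hm, he⟩ := List.mem_map.1 hmem
      exact hfresh m hm (Prod.mk.inj he)
    · intro m hm
      rcases List.mem_cons.1 hm with rfl | hm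
      · exact Or.inr ⟨i, j, hj, _, rfl⟩
      · exact h.shape m hm
    · rw [received_cons]
      split_ifs with hu
      · subst hu
        rw [← h.received_eq_countP hj] at hneed
        simp only [List.length_singleton]
        omega
      · simpa using h.received_le u

theorem runInvariant_of_reachable {log : List (Message n S.F)}
    (h : Relation.ReflTransGen (S.Step G) [] log) : S.RunInvariant G log := by
  induction h with
  | refl => exact ⟨by simp, by simp, by simp [received, symbols]⟩
  | tail _ hs ih => exact ih.step hs

theorem RunInvariant.length_le {log : List (Message n S.F)} (h : S.RunInvariant G log) :
    log.length ≤ (n + 1) * (n + 1) := by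
  simpa using h.links_nodup.length_le_card

theorem Step.length_eq {log log' : List (Message n S.F)} (hs : S.Step G log log') :
    log'.length = log.length + 1 := by
  cases hs <;> rfl

variable (S G) in
-- Each step uses a fresh ordered pair of nodes, so any maximal continuation terminates; the
-- induction is on a bound `b` for the number of pairs left.
theorem exists_completeRun : ∃ log, S.CompleteRun G log := by
  have key : ∀ b (log : List (Message n S.F)), Relation.ReflTransGen (S.Step G) [] log →
      (n + 1) * (n + 1) - log.length ≤ b → ∃ log, S.CompleteRun G log := by
    intro b
    induction b with
    | zero =>
      intro log hlog hb
      refine ⟨log, hlog, fun log' hs => ?_⟩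
      have := (runInvariant_of_reachable (hlog.tail hs)).length_le
      have := hs.length_eq
      omega
    | succ b ih =>
      intro log hlog hb
      by_cases hc : ∃ log', S.Step G log log'
      · obtain ⟨log', hs⟩ := hc
        have := hs.length_eq
        exact ih log' (hlog.tail hs) (by omega)
      · exact ⟨log, hlog, fun log' hs => hc ⟨log', hs⟩⟩
  exact key _ [] .refl le_rfl

theorem symbols_le_of_completeRun {log : List (Message n S.F)} (h : S.CompleteRun G log) :
    symbols log ≤ d * n := by
  have hinv := runInvariant_of_reachable h.1
  rw [symbols_eq_sum_received, Fintype.sum_option, hinv.received_none, zero_add]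
  refine (Finset.sum_le_sum fun i _ => hinv.received_le (some i)).trans ?_
  simp [mul_comm]

/-- The participants that have passed a value to participant `i`. -/
theorem RunInvariant.exists_senders {log : List (Message n S.F)} (h : S.RunInvariant G log)
    {i : Fin n} (hi : ¬ Direct G i) : ∃ A : Finset (Fin n),
      A.card = (log.countP fun m => decide (m.dst = some i)) ∧
      ∀ j, j ∈ A ↔ ∃ x, (⟨some j, some i, [x]⟩ : Message n S.F) ∈ log := by
  classical
  set L := (log.filter fun m => decide (m.dst = some i)).map Message.src with hL
  have hmem : ∀ j : Fin n, some j ∈ L ↔ ∃ x, (⟨some j, some i, [x]⟩ : Message n S.F) ∈ log := by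
    intro j
    constructor
    · intro hj
      obtain ⟨m, hm, hsrc⟩ := List.mem_map.1 hj
      obtain ⟨hmem, hdst⟩ := List.mem_filter.1 hm
      rcases h.shape m hmem with ⟨i', hi', v, rfl⟩ | ⟨j', i', -, x, rfl⟩
      · cases hsrc
      · obtain rfl : i' = i := by simpa using hdst
        obtain rfl : j' = j := by simpa using hsrc
        exact ⟨x, hmem⟩
    · rintro ⟨x, hx⟩
      exact List.mem_map.2 ⟨_, List.mem_filter.2 ⟨hx, by simp⟩, rfl⟩
  have hnone : none ∉ L := by
    intro hj
    obtain ⟨m, hm, hsrc⟩ := List.mem_map.1 hj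
    obtain ⟨hm, hdst⟩ := List.mem_filter.1 hm
    rcases h.shape m hm with ⟨i', hi', v, rfl⟩ | ⟨j', i', -, x, rfl⟩
    · obtain rfl : i' = i := by simpa using hdst
      exact hi hi'
    · cases hsrc
  have hnodup : L.Nodup := by
    refine List.Nodup.map_on ?_ (List.Nodup.filter _ (List.Nodup.of_map _ h.links_nodup))
    intro m hm m' hm' he
    obtain ⟨hm, hd⟩ := List.mem_filter.1 hm
    obtain ⟨hm', hd'⟩ := List.mem_filter.1 hm'
    refine List.inj_on_of_nodup_map h.links_nodup hm hm' ?_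
    rw [decide_eq_true_eq] at hd hd'
    simp [he, hd, hd']
  refine ⟨Finset.univ.filter fun j => some j ∈ L, ?_, fun j => by simp [hmem]⟩
  have himg : (Finset.univ.filter fun j : Fin n => some j ∈ L).map Function.Embedding.some =
      L.toFinset := by
    ext u
    cases u <;> simp [hnone]
  rw [← Finset.card_map Function.Embedding.some, himg, List.toFinset_card_of_nodup hnodup, hL,
    List.length_map, List.countP_eq_length_filter]

/-- In a completed execution, under the propagating-dealer condition, every participant holds its
vector, and it has received `d` symbols. -/
theorem holds_of_completeRun (hG : PropagatingDealer G d) {log : List (Message n S.F)}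
    (h : S.CompleteRun G log) (i : Fin n) : (∃ v, S.Holds G log i v) ∧ d ≤ received log (some i) := by
  classical
  have hinv := runInvariant_of_reachable h.1
  obtain ⟨rank, hrank⟩ := hG
  induction hr : (rank i : ℕ) using Nat.strong_induction_on generalizing i with
  | _ r ih =>
    by_cases hi : Direct G i
    · have hdealt : ∃ m ∈ log, m.src = none ∧ m.dst = some i := by
        by_contra hcon
        push Not at hcon
        exact h.2 _ (Step.deal log i hi fun m hm hmm => hcon m hm hmm.1 hmm.2)
      obtain ⟨m, hm, hsrc, hdst⟩ := hdealt
      rcases hinv.shape m hm with ⟨j, -, v, rfl⟩ | ⟨j, j', -, x, rfl⟩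
      · obtain rfl : j = i := by simpa using hdst
        exact ⟨⟨v, .dealt v hm⟩, by simpa using length_payload_le_received hm⟩
      · cases hsrc
    · obtain ⟨A, hAcard, hA⟩ := hinv.exists_senders hi
      have hd : d ≤ A.card := by
        by_contra hlt
        push Not at hlt
        have hprec := (hrank i).resolve_left hi
        -- With fewer than `d` senders, some preceding in-neighbour has not sent. By induction it
        -- holds a vector, so a `pass` is still possible, contradicting completeness.
        have hnot : ¬ {j : Fin n | rank j < rank i ∧ G.Adj (some j) (some i)} ⊆ (A : Set (Fin n)) := by
          intro hsub
          have := Set.ncard_le_ncard hsub A.finite_toSet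
          rw [Set.ncard_coe_finset] at this
          omega
        obtain ⟨j, ⟨hj, hadj⟩, hjA⟩ := Set.not_subset.1 hnot
        obtain ⟨⟨v, hv⟩, -⟩ := ih (rank j) (by rw [← hr]; exact hj) j rfl
        refine h.2 _ (Step.pass log j i v hadj hv hi (hAcard ▸ hlt) fun m hm hmm => hjA ?_)
        rcases hinv.shape m hm with ⟨j', -, v, rfl⟩ | ⟨j', i', -, x, rfl⟩
        · cases hmm.1
        · obtain ⟨h1, h2⟩ := hmm
          refine (hA j).2 ⟨x, ?_⟩
          simp only at h1 h2
          rwa [h1, h2] at hm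
      rw [hinv.received_eq_countP hi, ← hAcard]
      refine ⟨?_, hd⟩
      obtain ⟨B, hBA, hB⟩ := Finset.exists_subset_card_eq hd
      have hnb : ∀ a : Fin d, ∃ x, (⟨some (B.orderEmbOfFin hB a), some i, [x]⟩ : Message n S.F) ∈ log :=
        fun a => (hA _).1 (hBA (Finset.orderEmbOfFin_mem B hB a))
      choose σ hσ using hnb
      exact ⟨_, .solved hi _ (B.orderEmbOfFin hB).injective σ hσ⟩

theorem symbols_eq_of_completeRun (hG : PropagatingDealer G d) {log : List (Message n S.F)}
    (h : S.CompleteRun G log) : symbols log = d * n := by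
  refine le_antisymm (symbols_le_of_completeRun h) ?_
  rw [symbols_eq_sum_received, Fintype.sum_option]
  calc d * n = ∑ _i : Fin n, d := by simp [mul_comm]
    _ ≤ ∑ i : Fin n, received log (some i) :=
      Finset.sum_le_sum fun i _ => (holds_of_completeRun hG h i).2
    _ ≤ _ := Nat.le_add_left _ _

end SneakSetup

end SecretSharing

namespace SecretSharing

/-! ## Communication of separate transmissions over node-disjoint paths -/

/-- Propagates a property indexed by the number of hops along a walk. Taking `Q` to be a bound on
how far `t` hops can lead yields lower bounds on path lengths. -/
theorem isChain_cons_append_singleton_induction {V : Type*} {R : V → V → Prop} {Q : ℕ → V → Prop}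
    (hQ : ∀ t u v, Q t u → R u v → Q (t + 1) v) {x : V} :
    ∀ (l : List V) (t : ℕ) (u : V), Q t u → List.IsChain R (u :: (l ++ [x])) →
      Q (t + (l.length + 1)) x
  | [], t, u, hu, h => hQ t u x hu (by simpa using h)
  | v :: l, t, u, hu, h => by
    rw [List.cons_append, List.isChain_cons_cons] at h
    have := isChain_cons_append_singleton_induction hQ l (t + 1) v (hQ t u v hu h.1) h.2
    rwa [List.length_cons, show t + (l.length + 1 + 1) = t + 1 + (l.length + 1) by omega]

namespace Routes

variable {n k : ℕ} {G : Network n} {i : Fin n}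

theorem induction_mid (r : Routes G k i) {Q : ℕ → Option (Fin n) → Prop} (h0 : Q 0 none)
    (hQ : ∀ t u v, Q t u → G.Adj u v → Q (t + 1) v) (a : Fin r.w) :
    Q ((r.mid a).length + 1) (some i) := by
  have h := r.isPath a
  rw [List.map_append, List.map_singleton] at h
  simpa using isChain_cons_append_singleton_induction hQ _ 0 none h0 h

theorem mid_ne_nil (r : Routes G k i) (hi : ¬ Direct G i) (a : Fin r.w) : r.mid a ≠ [] := by
  intro h
  have hp := r.isPath a
  rw [h] at hp
  exact hi (by simpa [Direct] using hp)

/-- Disjoint paths to a participant outside the dealer's neighbourhood have distinct first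
intermediate nodes. The bound makes `w - k + 1` one of the numbers that divide `len`. -/
theorem w_le (r : Routes G k i) (hi : ¬ Direct G i) : r.w ≤ n := by
  have hinj : Function.Injective fun a => (r.mid a).head (r.mid_ne_nil hi a) := by
    intro a b hab
    by_contra hne
    have ha := List.head_mem (r.mid_ne_nil hi a)
    have hb := List.head_mem (r.mid_ne_nil hi b)
    simp only at hab
    rw [hab] at ha
    exact r.disjoint a b hne ha hb
  simpa using Fintype.card_le_of_injective _ hinj

theorem length_mid_lt (r : Routes G k i) (a : Fin r.w) : (r.mid a).length < n := by
  have := (r.nodup a).length_le_card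
  simpa using this

end Routes

namespace SotaSetup

variable {n k : ℕ} (S : SotaSetup n k) {G : Network n} {i : Fin n}

theorem symbols_routedMessages (r : Routes G k i) :
    symbols (S.routedMessages r) =
      ∑ a, ((r.mid a).length + 1) * (S.len / (r.w - k + 1)) := by
  unfold symbols routedMessages
  rw [List.map_flatMap, List.flatMap_def, List.sum_flatten, List.map_map, ← List.ofFn_eq_map,
    List.sum_ofFn]
  refine Finset.sum_congr rfl fun a _ => ?_
  simp only [Function.comp_apply, List.map_map]
  rw [List.map_congr_left (g := fun _ => S.len / (r.w - k + 1)) (by simp [chunk])]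
  simp [Routes.nodes]

/-- The `w` chunks together have at least the size of the share, as `w ≥ w - k + 1`, and each
travels at least `L` hops. -/
theorem mul_len_le_symbols (hk : 1 ≤ k) (r : Routes G k i) (hi : ¬ Direct G i) {L : ℕ}
    (hL : ∀ a, L ≤ (r.mid a).length + 1) : L * S.len ≤ symbols (S.routedMessages r) := by
  have hw := r.le_w
  have hdvd := S.dvd_len (r.w - k + 1) (by omega) (by have := r.w_le hi; omega)
  rw [symbols_routedMessages]
  calc L * S.len = L * ((r.w - k + 1) * (S.len / (r.w - k + 1))) := by
        rw [Nat.mul_div_cancel' hdvd]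
    _ ≤ L * (r.w * (S.len / (r.w - k + 1))) := by gcongr; omega
    _ = ∑ _a : Fin r.w, L * (S.len / (r.w - k + 1)) := by simp; ring
    _ ≤ _ := Finset.sum_le_sum fun a _ => Nat.mul_le_mul_right _ (hL a)

theorem symbols_le_mul_len (r : Routes G k i) :
    symbols (S.routedMessages r) ≤ r.w * n * S.len := by
  rw [symbols_routedMessages]
  calc _ ≤ ∑ _a : Fin r.w, n * S.len :=
        Finset.sum_le_sum fun a _ => Nat.mul_le_mul (r.length_mid_lt a) (Nat.div_le_self _ _)
    _ = _ := by simp; ring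

theorem natCast_le_div_len {L s : ℕ} (h : L * S.len ≤ s) :
    (L : ℝ≥0∞) ≤ (s : ℝ≥0∞) / (S.len : ℝ≥0∞) := by
  rw [ENNReal.le_div_iff_mul_le (Or.inl (by simpa using S.len_pos.ne')) (Or.inl (by simp))]
  exact_mod_cast h

theorem div_len_le_natCast {L s : ℕ} (h : s ≤ L * S.len) :
    (s : ℝ≥0∞) / (S.len : ℝ≥0∞) ≤ (L : ℝ≥0∞) :=
  ENNReal.div_le_of_le_mul (by exact_mod_cast h)

theorem symbols_directMessages (i : Fin n) : symbols (S.directMessages i) = S.len := by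
  simp [symbols, directMessages]

/-- Lower bound by lengths of paths: participants at distance at least `f i` cost `f i` units. -/
theorem sum_le_comm (hk : 1 ≤ k) (f : Fin n → ℕ) (hdirect : ∀ i, Direct G i → f i ≤ 1)
    (hroute : ∀ i, ¬ Direct G i → ∀ (r : Routes G k i) a, f i ≤ (r.mid a).length + 1) :
    ((∑ i, f i : ℕ) : ℝ≥0∞) ≤ S.comm G := by
  rw [Nat.cast_sum]
  unfold comm
  refine Finset.sum_le_sum fun i _ => ?_
  split_ifs with hi
  · refine S.natCast_le_div_len ?_
    rw [symbols_directMessages]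
    exact (Nat.mul_le_mul_right _ (hdirect i hi)).trans (one_mul _).le
  · exact le_iInf fun r => S.natCast_le_div_len (S.mul_len_le_symbols hk r hi (hroute i hi r))

theorem comm_le {L : ℕ} (hroute : ∀ i, ¬ Direct G i → ∃ r : Routes G k i, r.w ≤ L) (hL : 1 ≤ L) :
    S.comm G ≤ ((L * n ^ 2 : ℕ) : ℝ≥0∞) := by
  have hterm : S.comm G ≤ ∑ _i : Fin n, ((L * n : ℕ) : ℝ≥0∞) := by
    unfold comm
    refine Finset.sum_le_sum fun i _ => ?_
    split_ifs with hi
    · refine S.div_len_le_natCast ?_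
      rw [symbols_directMessages]
      exact Nat.le_mul_of_pos_left _ (Nat.mul_pos hL (Fin.pos i))
    · obtain ⟨r, hr⟩ := hroute i hi
      refine (iInf_le _ r).trans (S.div_len_le_natCast ((S.symbols_le_mul_len r).trans ?_))
      gcongr
  refine hterm.trans (le_of_eq ?_)
  rw [← Nat.cast_sum]
  congr 1
  simp
  ring

end SotaSetup

/-! ### Networks with small outgoing degrees -/

open Classical in
/-- The nodes within `t` hops of the dealer. -/
noncomputable def dealerBall {n : ℕ} (G : Network n) : ℕ → Finset (Option (Fin n))
  | 0 => {none}
  | t + 1 => dealerBall G t ∪ (dealerBall G t).biUnion fun u => Finset.univ.filter (G.Adj u)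

theorem card_dealerBall_le {n : ℕ} (G : Network n) (t : ℕ) :
    (dealerBall G t).card ≤ (1 + maxOutDegree G) ^ t := by
  classical
  induction t with
  | zero => simp [dealerBall]
  | succ t ih =>
    rw [dealerBall]
    refine (Finset.card_union_le _ _).trans ?_
    have hb : ((dealerBall G t).biUnion fun u => Finset.univ.filter (G.Adj u)).card ≤
        (dealerBall G t).card * maxOutDegree G := by
      refine Finset.card_biUnion_le_card_mul _ _ _ fun u _ => ?_
      rw [← Set.ncard_coe_finset]
      have : maxOutDegree G ≥ {v | G.Adj u v}.ncard :=
        Finset.le_sup (f := fun u => {v | G.Adj u v}.ncard) (Finset.mem_univ u)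
      simpa using this
    calc _ ≤ (dealerBall G t).card * (1 + maxOutDegree G) := by rw [mul_add, mul_one]; gcongr
      _ ≤ _ := by rw [pow_succ]; gcongr

theorem mem_dealerBall_succ {n : ℕ} {G : Network n} {t : ℕ} {u v : Option (Fin n)}
    (hu : u ∈ dealerBall G t) (h : G.Adj u v) : v ∈ dealerBall G (t + 1) := by
  rw [dealerBall]
  exact Finset.mem_union_right _ (Finset.mem_biUnion.2 ⟨u, hu, by simpa using h⟩)

theorem dealerBall_mono {n : ℕ} (G : Network n) : Monotone (dealerBall G) :=
  monotone_nat_of_le_succ fun t => by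
    rw [dealerBall]
    exact Finset.subset_union_left

/-- If at most half of the participants lie within `L` hops, the average cost is at least
`L / 2`. -/
theorem SotaSetup.mul_le_comm {n k : ℕ} (S : SotaSetup n k) (hk : 1 ≤ k) {G : Network n} {x : ℕ}
    (h : 2 * (1 + maxOutDegree G) ^ (2 * (x + 1)) ≤ n) :
    (((x + 1) * n : ℕ) : ℝ≥0∞) ≤ S.comm G := by
  classical
  set L := 2 * (x + 1) with hL
  -- Participants in the ball are charged nothing and the others `L`. At least `n / 2` are outside,
  -- and `L / 2 = x + 1`.
  refine le_trans ?_ (S.sum_le_comm hk (fun i => if some i ∈ dealerBall G L then 0 else L) ?_ ?_)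
  · have hcard : n ≤ (Finset.univ.filter fun i : Fin n => some i ∉ dealerBall G L).card +
        (1 + maxOutDegree G) ^ L := by
      have h1 := Finset.card_filter_add_card_filter_not (s := (Finset.univ : Finset (Fin n)))
        (fun i => some i ∈ dealerBall G L)
      have h2 : (Finset.univ.filter fun i : Fin n => some i ∈ dealerBall G L).card ≤
          (dealerBall G L).card := by
        rw [← Finset.card_map Function.Embedding.some]
        refine Finset.card_le_card fun u hu => ?_
        obtain ⟨i, hi, rfl⟩ := Finset.mem_map.1 hu
        exact (Finset.mem_filter.1 hi).2
      have h3 := card_dealerBall_le G L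
      rw [Finset.card_univ, Fintype.card_fin] at h1
      omega
    refine Nat.cast_le.2 ?_
    simp only [← ite_not (some _ ∈ dealerBall G L)]
    rw [← Finset.sum_filter, Finset.sum_const, smul_eq_mul, hL]
    have : n ≤ 2 * (Finset.univ.filter fun i : Fin n => some i ∉ dealerBall G L).card := by omega
    nlinarith
  · intro i hi
    have h1 : some i ∈ dealerBall G 1 := mem_dealerBall_succ (t := 0) (by simp [dealerBall]) hi
    simp [dealerBall_mono G (show 1 ≤ L by omega) h1]
  · intro i _ r a
    have hmem := r.induction_mid (Q := fun t u => u ∈ dealerBall G t) (by simp [dealerBall])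
      (fun _ _ _ => mem_dealerBall_succ) a
    split_ifs with hball
    · exact Nat.zero_le _
    · by_contra hlt
      exact hball (dealerBall_mono G (by omega) hmem)

/-- The left side is polylogarithmic in `N m`, for fixed `L`, hence eventually below `N m`. -/
theorem eventually_two_mul_pow_le {N D : ℕ → ℕ} {e : ℝ} (he : e ≤ 1) (hN : Tendsto N atTop atTop)
    (hD : (fun m => (D m : ℝ)) =O[atTop] fun m => Real.log (N m) ^ e) (L : ℕ) :
    ∀ᶠ m in atTop, 2 * (1 + D m) ^ L ≤ N m := by
  obtain ⟨c, hc, hDc⟩ := hD.exists_pos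
  have hNr : Tendsto (fun m => (N m : ℝ)) atTop atTop := tendsto_natCast_atTop_atTop.comp hN
  have hpow := (Real.isLittleO_pow_log_id_atTop (n := L)).comp_tendsto hNr
  have hconst : 0 < 1 / (2 * (1 + c) ^ L) := by positivity
  filter_upwards [hDc.bound, hpow.bound hconst,
    (Real.tendsto_log_atTop.comp hNr).eventually_ge_atTop 1] with m h1 h2 h3
  simp only [Function.comp_apply, id, Real.norm_eq_abs] at h1 h2 h3
  set l := Real.log (N m)
  have hl : 0 ≤ l ^ e := Real.rpow_nonneg (by linarith) e
  rw [abs_of_nonneg (Nat.cast_nonneg _), abs_of_nonneg hl] at h1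
  rw [abs_of_nonneg (by positivity), abs_of_nonneg (Nat.cast_nonneg _)] at h2
  have h4 : l ^ e ≤ l := by
    simpa using Real.rpow_le_rpow_of_exponent_le h3 he
  -- The logarithm `l` is at least `1`, so it absorbs the summand `1` as well as `l ^ e`.
  have h5 : (1 + D m : ℝ) ≤ (1 + c) * l := by nlinarith
  have h6 : (1 + D m : ℝ) ^ L ≤ (1 + c) ^ L * l ^ L := by
    rw [← mul_pow]
    gcongr
  have h7 : 2 * ((1 + c) ^ L * l ^ L) ≤ N m := by
    calc 2 * ((1 + c) ^ L * l ^ L) ≤ 2 * ((1 + c) ^ L * (1 / (2 * (1 + c) ^ L) * N m)) := by gcongr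
      _ = N m := by field_simp
  have h8 : (2 * (1 + D m : ℝ) ^ L) ≤ N m := by linarith
  exact_mod_cast h8

/-! ### A class of networks with quadratic communication -/

/-- The dealer is connected to the first `d` participants, and each participant to the next `d`
participants. -/
def slidingNetwork (d n : ℕ) : Network n where
  Adj
    | none, some j => (j : ℕ) < d
    | some i, some j => i < j ∧ (j : ℕ) ≤ i + d
    | _, none => False

theorem direct_slidingNetwork {d n : ℕ} {i : Fin n} :
    Direct (slidingNetwork d n) i ↔ (i : ℕ) < d := Iff.rfl

theorem propagatingDealer_slidingNetwork (d n : ℕ) : PropagatingDealer (slidingNetwork d n) d := by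
  refine ⟨Equiv.refl _, fun i => ?_⟩
  rw [direct_slidingNetwork, or_iff_not_imp_left, not_lt]
  intro hi
  -- The `d` immediate predecessors of `i`.
  let f : Fin d → Fin n := fun a => ⟨i - 1 - a, by omega⟩
  have hf : Function.Injective f := by
    intro a b hab
    have := Fin.mk.inj hab
    exact Fin.ext (by omega)
  have hsub : Set.range f ⊆
      {j : Fin n | Equiv.refl (Fin n) j < Equiv.refl (Fin n) i ∧
        (slidingNetwork d n).Adj (some j) (some i)} := by
    rintro _ ⟨a, rfl⟩
    have : (f a : ℕ) = i - 1 - a := rfl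
    refine ⟨?_, ?_, ?_⟩
    · simp only [Equiv.refl_apply, Fin.lt_def]; omega
    · simp only [Fin.lt_def]; omega
    · omega
  have := Set.ncard_le_ncard hsub (Set.toFinite _)
  rwa [Set.ncard_range_of_injective hf, Nat.card_eq_fintype_card, Fintype.card_fin] at this

/-- The path to participant `i` through the participants of a residue class mod `d`. -/
def slidingPath {d n : ℕ} (i : Fin n) (a : Fin d) (ha : (a : ℕ) < i) : List (Fin n) :=
  List.ofFn fun t : Fin ((i - 1 - a) / d + 1) => ⟨a + t * d, by
    have h1 : (t : ℕ) * d ≤ (i - 1 - a) / d * d := Nat.mul_le_mul_right _ (by omega)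
    have h2 := Nat.div_mul_le_self (i - 1 - a) d
    omega⟩

/-- The residue identifies the path, which makes paths with different `a` disjoint; the inequality
keeps the endpoint `i` off them. -/
theorem slidingPath_lt {d n : ℕ} {i : Fin n} {a : Fin d} {ha : (a : ℕ) < i} {j : Fin n}
    (hj : j ∈ slidingPath i a ha) : j < i ∧ (j : ℕ) % d = a := by
  obtain ⟨t, rfl⟩ := List.mem_ofFn.1 hj
  have h1 : (t : ℕ) * d ≤ (i - 1 - a) / d * d := Nat.mul_le_mul_right _ (by omega)
  have h2 := Nat.div_mul_le_self (i - 1 - a) d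
  refine ⟨?_, ?_⟩
  · simp only [Fin.lt_def]; omega
  · simp [Nat.mod_eq_of_lt a.2]

theorem isChain_slidingPath {d n : ℕ} {i : Fin n} {a : Fin d} (ha : (a : ℕ) < i) :
    List.IsChain (slidingNetwork d n).Adj (none :: (slidingPath i a ha ++ [i]).map some) := by
  have hd : 0 < d := a.pos
  rw [List.isChain_cons]
  constructor
  · simp [slidingPath, slidingNetwork]
  rw [List.isChain_map, List.isChain_append]
  refine ⟨?_, by simp, ?_⟩
  · unfold slidingPath
    rw [List.isChain_ofFn]
    intro t ht
    simp only [slidingNetwork, Fin.lt_def]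
    constructor <;> nlinarith
  -- The last intermediate node is the largest number below `i` congruent to `a` mod `d`, so it is
  -- within `d` of `i`.
  · have h3 := Nat.lt_div_mul_add (a := (i : ℕ) - 1 - a) hd
    have h2 := Nat.div_mul_le_self ((i : ℕ) - 1 - a) d
    intro x hx y hy
    obtain rfl : i = y := by simpa using hy
    simp [slidingPath, List.getLast?_eq_getElem?, -List.ofFn_succ] at hx
    subst hx
    simp only [slidingNetwork, Fin.lt_def]
    constructor <;> omega

/-- The `d` node-disjoint paths to a participant not connected to the dealer. -/
def slidingRoutes {k d n : ℕ} (hkd : k ≤ d) (i : Fin n) (hi : d ≤ i) :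
    Routes (slidingNetwork d n) k i where
  w := d
  le_w := hkd
  mid a := slidingPath i a (by omega)
  isPath a := isChain_slidingPath _
  nodup a := by
    rw [List.nodup_append]
    refine ⟨List.nodup_ofFn.2 fun s t hst => ?_, by simp, fun x hx y hy => ?_⟩
    · have := Fin.mk.inj hst
      exact Fin.ext (Nat.eq_of_mul_eq_mul_right a.pos (by omega))
    · rw [List.mem_singleton.1 hy]
      exact (slidingPath_lt hx).1.ne
  disjoint a b hab x hxa hxb :=
    hab (Fin.ext ((slidingPath_lt hxa).2.symm.trans (slidingPath_lt hxb).2))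

theorem comm_slidingNetwork_le {k d n : ℕ} (hk : 1 ≤ k) (hkd : k ≤ d) (S : SotaSetup n k) :
    S.comm (slidingNetwork d n) ≤ ((d * n ^ 2 : ℕ) : ℝ≥0∞) :=
  S.comm_le (fun i hi => ⟨slidingRoutes hkd i (not_lt.1 hi), le_rfl⟩) (hk.trans hkd)

theorem le_comm_slidingNetwork {k d n : ℕ} (hk : 1 ≤ k) (hd : 0 < d) (S : SotaSetup n k) :
    ((n ^ 2 : ℕ) : ℝ≥0∞) / (2 * d : ℕ) ≤ S.comm (slidingNetwork d n) := by
  -- This is `(i + 1) / d` rounded up, the least number of hops that can reach the zero-based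
  -- position `i`.
  refine le_trans ?_ (S.sum_le_comm hk (fun i => (i + d) / d) ?_ ?_)
  · refine ENNReal.div_le_of_le_mul ?_
    rw [← Nat.cast_mul, Nat.cast_le, Finset.sum_mul, Fin.sum_univ_eq_sum_range
      (fun i => (i + d) / d * (2 * d))]
    calc n ^ 2 ≤ ∑ i ∈ Finset.range n, 2 * (i + 1) := by
          rw [← Finset.mul_sum, Finset.sum_add_distrib, mul_add, mul_comm 2,
            Finset.sum_range_id_mul_two]
          cases n <;> simp
          nlinarith
      _ ≤ _ := by
          refine Finset.sum_le_sum fun i _ => ?_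
          have := Nat.lt_div_mul_add (a := i + d) hd
          nlinarith
  · intro i hi
    rw [direct_slidingNetwork] at hi
    exact Nat.le_of_lt_succ (Nat.div_lt_of_lt_mul (by omega))
  · intro i _ r a
    -- After `t` hops at most the first `d * t` participants are reachable, the dealer counting as
    -- position `0` in the one-based numbering.
    have := r.induction_mid (Q := fun t u => (u.elim 0 fun j => (j : ℕ) + 1) ≤ d * t)
      (by simp) (fun t u v hu huv => ?_) a
    · simp only [Option.elim_some] at this
      refine Nat.le_of_lt_succ (Nat.div_lt_of_lt_mul ?_)
      rw [Nat.succ_eq_add_one, mul_add]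
      omega
    · rw [mul_add, mul_one]
      rcases u with - | u <;> rcases v with - | v
      · exact huv.elim
      · have : (v : ℕ) < d := huv
        simp only [Option.elim_some]; omega
      · exact huv.elim
      · have : (v : ℕ) ≤ u + d := huv.2
        simp only [Option.elim_some] at hu ⊢; omega

end SecretSharing

/-! ### The three assertions with explicit constants -/

theorem mainTheorem6 (k d : ℕ) (hk : 2 ≤ k) (hd : k ≤ d) :
    -- SNEAK: linear communication, within a constant factor of every secret sharing algorithm
    (∃ c C K : ℝ, 0 < c ∧ 0 < C ∧ 0 < K ∧
      ∀ (n : ℕ), k ≤ n → ∀ G : SecretSharing.Network n, SecretSharing.PropagatingDealer G d →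
        ∀ S : SecretSharing.SneakSetup n k d,
          (∃ log, S.CompleteRun G log) ∧
          ∀ log, S.CompleteRun G log →
            c * n ≤ S.comm log ∧ S.comm log ≤ C * n ∧
            ∀ P : SecretSharing.Protocol n, P.IsSecretSharing G k →
              S.comm log ≤ K * P.comm G) ∧
    -- separate secure transmissions: super-linear when the outgoing degrees grow slowly
    (∀ ε : ℝ, 0 < ε → ∀ N : ℕ → ℕ, Tendsto N atTop atTop →
      ∀ G : ∀ m, SecretSharing.Network (N m),
        (fun m => (SecretSharing.maxOutDegree (G m) : ℝ)) =O[atTop]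
          (fun m => Real.log (N m) ^ (1 / 2 - ε)) →
        ∀ S : ∀ m, SecretSharing.SotaSetup (N m) k,
          Tendsto (fun m => (S m).comm (G m) / (N m : ℝ≥0∞)) atTop (𝓝 ⊤)) ∧
    -- separate secure transmissions: quadratic on a class of networks
    (∃ 𝒞 : ∀ n, Set (SecretSharing.Network n), (∀ n, d < n → (𝒞 n).Nonempty) ∧
      ∃ c C : ℝ≥0, 0 < c ∧ ∀ n, d < n → ∀ G ∈ 𝒞 n, SecretSharing.PropagatingDealer G d ∧
        ∀ S : SecretSharing.SotaSetup n k,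
          (c : ℝ≥0∞) * (n : ℝ≥0∞) ^ 2 ≤ S.comm G ∧
          S.comm G ≤ (C : ℝ≥0∞) * (n : ℝ≥0∞) ^ 2) := by
  have hk1 : 1 ≤ k := by omega
  refine ⟨?_, ?_, ?_⟩
  · have hu : (0 : ℝ) < ((d - k + 1 : ℕ) : ℝ) := by positivity
    have hu1 : (1 : ℝ) ≤ ((d - k + 1 : ℕ) : ℝ) := by exact_mod_cast Nat.le_add_left 1 _
    have hd0 : (0 : ℝ) < d := by exact_mod_cast (by omega : 0 < d)
    -- The communication is exactly `d * n / (d - k + 1)` units, so both linear constants coincide;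
    -- `K = 2 * d` combines `n ≤ 2 * P.comm G` with dropping the divisor, which is at least `1`.
    refine ⟨d / ((d - k + 1 : ℕ) : ℝ), d / ((d - k + 1 : ℕ) : ℝ), 2 * d, by positivity,
      by positivity, by positivity, fun n hn G hG S => ⟨S.exists_completeRun G, fun log hlog => ?_⟩⟩
    have hcomm : S.comm log = d / ((d - k + 1 : ℕ) : ℝ) * n := by
      rw [SecretSharing.SneakSetup.comm, SecretSharing.SneakSetup.symbols_eq_of_completeRun hG hlog]
      push_cast
      ring
    refine ⟨hcomm.ge, hcomm.le, fun P hP => ?_⟩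
    rw [hcomm]
    calc d / ((d - k + 1 : ℕ) : ℝ) * n ≤ d * n := by
          gcongr
          exact div_le_self hd0.le hu1
      _ ≤ d * (2 * P.comm G) := by gcongr; exact P.le_two_mul_comm hk1 hn hP
      _ = 2 * d * P.comm G := by ring
  · intro ε hε N hN G hG S
    rw [ENNReal.tendsto_nhds_top_iff_nat]
    intro x
    filter_upwards [SecretSharing.eventually_two_mul_pow_le (by linarith) hN hG (2 * (x + 1)),
      hN.eventually_ge_atTop 1] with m hm hm1
    have hle := (S m).mul_le_comm hk1 hm
    have hlt : (x : ℝ≥0∞) < ((x + 1 : ℕ) : ℝ≥0∞) := by exact_mod_cast x.lt_succ_self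
    refine hlt.trans_le ?_
    rw [ENNReal.le_div_iff_mul_le (Or.inl (by simp; omega)) (Or.inl (by simp)), ← Nat.cast_mul]
    exact hle
  · refine ⟨fun n => {SecretSharing.slidingNetwork d n}, fun n _ => Set.singleton_nonempty _,
      ((2 * d : ℕ) : ℝ≥0)⁻¹, (d : ℝ≥0), ?_, fun n _ G hG => ?_⟩
    · have : 0 < 2 * d := by omega
      positivity
    obtain rfl := Set.mem_singleton_iff.1 hG
    refine ⟨SecretSharing.propagatingDealer_slidingNetwork d n, fun S => ⟨?_, ?_⟩⟩
    · refine le_trans (le_of_eq ?_) (SecretSharing.le_comm_slidingNetwork hk1 (by omega) S)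
      rw [ENNReal.coe_inv (by simp; omega), div_eq_mul_inv, mul_comm]
      simp
    · refine (SecretSharing.comm_slidingNetwork_le hk1 hd S).trans (le_of_eq ?_)
      push_cast
      rfl
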